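/- Let $\Omega\subset\mathbb R^n$ be open, let $(X,d)$ be a metric space, and let $f:\Omega\to X$ be $L$-Lipschitz. We say that $f$ is metrically differentiable at $x\in\Omega$ if there is a (necessarily unique) seminorm $\operatorname{md}(f,x)$ on $\mathbb R^n$ such that $$\lim_{y\to x}\frac{d(f(y),f(x))-\operatorname{md}(f,x)(y-x)}{|y-x|}=0 .$$ The rank of a seminorm $\sigma$ on $\mathbb R^n$ is $\operatorname{rank}\sigma=n-\dim\{v\in\mathbb R^n:\sigma(v)=0\}$. For $0\le k\le n$ let $E_k$ be the set of those $x\in\Omega$ at which $f$ is metrically differentiable with $\operatorname{rank}\operatorname{md}(f,x)=k$. Then (Lebesgue) almost every $x\in E_k$ has the following property: for every integer $m\ge 1$ there exists $r_{x,m}>0$ such that for all $0<r<r_{x,m}$ the open ball $B(x,r)$ is contained in $\Omega$ and - if $k>0$, then $f(B(x,r))$ can be covered by $m^k$ open balls of $X$, each of radius $3\sqrt{k}\,Lr/m$; - if $k=0$, then $f(B(x,r))$ is contained in one open ball of $X$ of radius $r/m$. -/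

import Mathlib

open MeasureTheory Filter Topology
open scoped NNReal

/-- The null space `N_σ = {v : σ v = 0}` of a seminorm, as a linear subspace. -/
def Seminorm.nullSpace {n : ℕ} (σ : Seminorm ℝ (EuclideanSpace ℝ (Fin n))) :
    Submodule ℝ (EuclideanSpace ℝ (Fin n)) where
  carrier := {v | σ v = 0}
  zero_mem' := map_zero σ
  add_mem' := by
    intro v w hv hw
    have hv' : σ v = 0 := hv
    have hw' : σ w = 0 := hw
    refine le_antisymm ?_ (apply_nonneg σ _)
    simpa [hv', hw'] using map_add_le_add σ v w
  smul_mem' := by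
    intro c v hv
    have hv' : σ v = 0 := hv
    show σ (c • v) = 0
    rw [map_smul_eq_mul, hv', mul_zero]

/-- The rank of a seminorm on `ℝⁿ`: `n - dim N_σ`. The subtraction never truncates. -/
noncomputable def Seminorm.rank {n : ℕ} (σ : Seminorm ℝ (EuclideanSpace ℝ (Fin n))) : ℕ :=
  n - Module.finrank ℝ σ.nullSpace

/-- The seminorm `σ` is a metric derivative of `f` at `x`:
`(d (f y) (f x) - σ (y - x)) / |y - x| → 0` as `y → x`, `y ≠ x`. If `x` is an interior point of
`Ω`, this depends only on the restriction of `f` to `Ω`. -/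
def HasMetricDerivAt {n : ℕ} {X : Type*} [MetricSpace X] (f : EuclideanSpace ℝ (Fin n) → X)
    (σ : Seminorm ℝ (EuclideanSpace ℝ (Fin n))) (x : EuclideanSpace ℝ (Fin n)) : Prop :=
  Tendsto (fun y => (dist (f y) (f x) - σ (y - x)) / ‖y - x‖) (𝓝[≠] x) (𝓝 0)

/-- The metric derivative is unique, so that one may speak of its rank. -/
theorem HasMetricDerivAt.unique {n : ℕ} {X : Type*} [MetricSpace X]
    {f : EuclideanSpace ℝ (Fin n) → X} {σ τ : Seminorm ℝ (EuclideanSpace ℝ (Fin n))}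
    {x : EuclideanSpace ℝ (Fin n)} (hσ : HasMetricDerivAt f σ x) (hτ : HasMetricDerivAt f τ x) :
    σ = τ := by
  ext v
  by_cases hv : v = 0
  · simp [hv]
  have hline : Tendsto (fun t : ℝ => x + t • v) (𝓝[>] 0) (𝓝[≠] x) := by
    refine tendsto_nhdsWithin_iff.2 ⟨?_, ?_⟩
    · have hc : Continuous (fun t : ℝ => x + t • v) := by fun_prop
      have := hc.tendsto 0
      simp only [zero_smul, add_zero] at this
      exact this.mono_left nhdsWithin_le_nhds
    · filter_upwards [self_mem_nhdsWithin] with t ht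
      have ht' : t ≠ 0 := ne_of_gt ht
      simp [ht', hv]
  have h := (hσ.sub hτ).comp hline
  have hconst : Tendsto (fun _ : ℝ => (τ v - σ v) / ‖v‖) (𝓝[>] 0) (𝓝 (0 - 0)) := by
    refine h.congr' ?_
    filter_upwards [self_mem_nhdsWithin] with t ht
    have ht' : (0 : ℝ) < t := ht
    have hv' : ‖v‖ ≠ 0 := norm_ne_zero_iff.2 hv
    simp only [Function.comp, add_sub_cancel_left, map_smul_eq_mul, norm_smul, Real.norm_eq_abs,
      abs_of_pos ht']
    field_simp
    ring
  have h0 := tendsto_nhds_unique hconst tendsto_const_nhds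
  have hv' : ‖v‖ ≠ 0 := norm_ne_zero_iff.2 hv
  rw [sub_zero, eq_comm, div_eq_zero_iff] at h0
  rcases h0 with h0 | h0
  · linarith
  · exact absurd h0 hv'

/-- `E_k`: the points of `Ω` at which `f` is metrically differentiable with a metric derivative
of rank `k`. -/
def metricRankSet {n : ℕ} {X : Type*} [MetricSpace X] (f : EuclideanSpace ℝ (Fin n) → X)
    (Ω : Set (EuclideanSpace ℝ (Fin n))) (k : ℕ) : Set (EuclideanSpace ℝ (Fin n)) :=
  {x | x ∈ Ω ∧ ∃ σ : Seminorm ℝ (EuclideanSpace ℝ (Fin n)), HasMetricDerivAt f σ x ∧ σ.rank = k}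

/-!
Almost everywhere in `Ω`, the upper bound contained in the metric derivative `σ` of `f` at `x`
improves to one between any two points near `x`:
`d (f y) (f z) ≤ σ (y - z) + o(|y - x| + |z - x|)`.
Indeed, the space of seminorms is separable, so there are countably many sets `A` which cover the
points of metric differentiability and on each of which the first-order bound holds, up to `ε`,
with a fixed seminorm and at a fixed scale. At a density point `x` of `A`, every `z` near `x` has a
point of `A` within `o(|z - x|)`, and since `f` is Lipschitz the bound at that point can be
transported to `z`.

Given this, `f` maps two points of `B(x, r)` that differ by an element of the null space of `σ` to
points at distance `o(r)`. Hence it is enough to cover the projection of the ball to the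
`k`-dimensional orthogonal complement of the null space by a grid of `mᵏ` points; there `σ ≤ L |·|`.
The resulting radius is `(√k L / m + ε) r` for any `ε > 0`, which covers both cases of the theorem;
`L > 0` if `k > 0`, because `σ ≠ 0`.
-/

theorem ae_eventually_exists_mem_dist_le_mul {E : Type*} [MetricSpace E]
    [SecondCountableTopology E] [MeasurableSpace E] [BorelSpace E] (μ : Measure E)
    [IsUnifLocDoublingMeasure μ] [IsLocallyFiniteMeasure μ] (A : Set E) {η : ℝ} (hη : 0 < η) :
    ∀ᵐ x ∂μ, x ∈ A → ∀ᶠ y in 𝓝 x, ∃ z ∈ A, dist z y ≤ η * dist y x := by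
  filter_upwards [ae_imp_of_ae_restrict
    (IsUnifLocDoublingMeasure.ae_tendsto_measure_inter_div μ A η⁻¹)] with x hx hxA
  have hradius : Tendsto (fun y => η * dist y x) (𝓝[≠] x) (𝓝[>] 0) := by
    refine tendsto_nhdsWithin_iff.2 ⟨?_, ?_⟩
    · have hcont : Continuous fun y => η * dist y x := by fun_prop
      exact (hcont.tendsto' x 0 (by simp)).mono_left nhdsWithin_le_nhds
    · filter_upwards [self_mem_nhdsWithin] with y hy
      exact mul_pos hη (dist_pos.2 hy)
  have hdensity := hx hxA id (fun y => η * dist y x) hradius <| .of_forall fun y => by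
    simp [inv_mul_cancel_left₀ hη.ne', dist_comm]
  have hne : ∀ᶠ y in 𝓝[≠] x, ∃ z ∈ A, dist z y ≤ η * dist y x := by
    filter_upwards [hdensity.eventually_ne one_ne_zero] with y hy
    by_contra! hfar
    have hempty : A ∩ Metric.closedBall y (η * dist y x) = ∅ :=
      Set.eq_empty_of_forall_notMem fun z hz => (hfar z hz.1).not_ge hz.2
    simp [hempty] at hy
  rw [eventually_nhdsWithin_iff] at hne
  filter_upwards [hne] with y hy
  obtain rfl | hyx := eq_or_ne y x
  · exact ⟨y, hxA, by simp⟩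
  · exact hy hyx

section Majorants

variable {E X : Type*} [NormedAddCommGroup E] [NormedSpace ℝ E] [PseudoMetricSpace X]

theorem seminorm_le_mul_norm_of_eventually {σ : Seminorm ℝ E} {C : ℝ}
    (h : ∀ᶠ w in 𝓝 (0 : E), σ w ≤ C * ‖w‖) (v : E) : σ v ≤ C * ‖v‖ := by
  have hline : Tendsto (fun t : ℝ => t • v) (𝓝[>] 0) (𝓝 0) :=
    (Continuous.tendsto' (by fun_prop) 0 0 (zero_smul ℝ v)).mono_left nhdsWithin_le_nhds
  obtain ⟨t, hle, ht⟩ := ((hline.eventually h).and self_mem_nhdsWithin).exists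
  rw [map_smul_eq_mul, norm_smul, mul_left_comm] at hle
  exact le_of_mul_le_mul_left hle (norm_pos_iff.2 (Set.mem_Ioi.1 ht).ne')

variable (E) in
theorem exists_seq_seminorm_dense [FiniteDimensional ℝ E] :
    ∃ τ : ℕ → Seminorm ℝ E, ∀ (σ : Seminorm ℝ E) {η : ℝ}, 0 < η →
      ∃ i, ∀ w, |σ w - τ i w| ≤ η * ‖w‖ := by
  let K := Metric.closedBall (0 : E) 1
  have : CompactSpace K := isCompact_iff_compactSpace.1 (isCompact_closedBall _ _)
  let restrict : Seminorm ℝ E → C(K, ℝ) := fun σ =>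
    ⟨fun u => σ u, σ.convexOn.locallyLipschitz.continuous.comp continuous_subtype_val⟩
  let g := TopologicalSpace.denseSeq (Set.range restrict)
  choose τ hτ using fun i => (g i).2
  refine ⟨τ, fun σ η hη => ?_⟩
  obtain ⟨i, hi⟩ := (TopologicalSpace.denseRange_denseSeq (Set.range restrict)).exists_dist_lt
    ⟨restrict σ, σ, rfl⟩ hη
  refine ⟨i, fun w => ?_⟩
  obtain rfl | hw := eq_or_ne w 0
  · simp
  have hw' : 0 < ‖w‖ := norm_pos_iff.2 hw
  have hu : ‖w‖⁻¹ • w ∈ K := by simp [K, norm_smul, hw'.ne']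
  have hunit : |σ (‖w‖⁻¹ • w) - τ i (‖w‖⁻¹ • w)| ≤ η := by
    have hle := (ContinuousMap.dist_apply_le_dist (f := restrict σ) (g := g i) ⟨_, hu⟩).trans hi.le
    rwa [← hτ i] at hle
  rwa [map_smul_eq_mul, map_smul_eq_mul, ← mul_sub, abs_mul, norm_inv, norm_norm,
    abs_of_pos (inv_pos.2 hw'), inv_mul_le_iff₀ hw', mul_comm] at hunit

/-- `σ` bounds the increments of `f` from the base point `x` to first order. This is the upper half
of metric differentiability at `x`. -/
def IsMetricMajorantAt (f : E → X) (σ : Seminorm ℝ E) (x : E) : Prop :=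
  ∀ ε > 0, ∀ᶠ y in 𝓝 x, dist (f y) (f x) ≤ σ (y - x) + ε * ‖y - x‖

/-- `σ` bounds the increments of `f` between any two points near `x`, with an error that is small
compared to their distances from `x` (not compared to the distance between them). -/
def IsJointMetricMajorantAt (f : E → X) (σ : Seminorm ℝ E) (x : E) : Prop :=
  ∀ ε > 0, ∀ᶠ p : E × E in 𝓝 (x, x),
    dist (f p.1) (f p.2) ≤ σ (p.1 - p.2) + ε * (‖p.1 - x‖ + ‖p.2 - x‖)

/-- The points at which the first-order bound of `IsMetricMajorantAt`, for the fixed error `ε`,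
already holds on the ball of radius `δ`. For `σ` in a dense sequence and `δ = 1 / (j + 1)`, these
sets split the domain into countably many pieces on which the bound is uniform. -/
def uniformMajorantSet (f : E → X) (σ : Seminorm ℝ E) (ε δ : ℝ) : Set E :=
  {z | ∀ y, dist y z < δ → dist (f y) (f z) ≤ σ (y - z) + ε * ‖y - z‖}

/-- The bound at `z` is transported to the pair `(a, b)` by comparing it with `(z + (a - b), z)`,
where `z` is a point of the majorant set that is much closer to `b` than `b` is to `x`. -/
theorem eventually_dist_le_of_uniformMajorantSet {f : E → X} {Ω : Set E} {L : ℝ≥0}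
    (hf : LipschitzOnWith L f Ω) {x : E} (hΩ : Ω ∈ 𝓝 x) {τ : Seminorm ℝ E} {ε η δ : ℝ}
    (hε : 0 ≤ ε) (hη : 0 ≤ η) (hδ : 0 < δ)
    (hA : ∀ᶠ y in 𝓝 x, ∃ z ∈ uniformMajorantSet f τ ε δ, dist z y ≤ η * dist y x) :
    ∀ᶠ p : E × E in 𝓝 (x, x), dist (f p.1) (f p.2) ≤
      τ (p.1 - p.2) + (ε + 2 * L * η) * (‖p.1 - x‖ + ‖p.2 - x‖) := by
  obtain ⟨R, hR, hball⟩ := Metric.mem_nhds_iff.1 hΩ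
  have hclose : ∀ᶠ p : E × E in 𝓝 (x, x), ‖p.1 - p.2‖ < δ :=
    (Continuous.tendsto' (by fun_prop) (x, x) 0 (by simp)).eventually_lt_const hδ
  have hinside : ∀ᶠ p : E × E in 𝓝 (x, x), ‖p.1 - x‖ + (1 + η) * ‖p.2 - x‖ < R :=
    (Continuous.tendsto' (by fun_prop) (x, x) 0 (by simp)).eventually_lt_const hR
  filter_upwards [hclose, hinside, continuous_snd.continuousAt.eventually hA]
    with ⟨a, b⟩ hab hin ⟨z, hz, hzb⟩
  simp only [dist_eq_norm b x] at hab hin hzb ⊢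
  have hmem : ∀ q, ‖q - x‖ ≤ ‖a - x‖ + (1 + η) * ‖b - x‖ → q ∈ Ω := fun q hq =>
    hball (mem_ball_iff_norm.2 (hq.trans_lt hin))
  have hηb : 0 ≤ η * ‖b - x‖ := by positivity
  have haΩ : a ∈ Ω := hmem a (by linarith [norm_nonneg (b - x)])
  have hbΩ : b ∈ Ω := hmem b (by linarith [norm_nonneg (a - x)])
  have hzΩ : z ∈ Ω := hmem z (by
    have := norm_sub_le_norm_sub_add_norm_sub z b x
    linarith [dist_eq_norm z b, norm_nonneg (a - x)])
  have hshift : dist a (a - b + z) = dist z b := by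
    rw [dist_eq_norm, dist_eq_norm, ← norm_neg]; congr 1; abel
  have hshiftΩ : a - b + z ∈ Ω := hmem _ (by
    have := norm_sub_le_norm_sub_add_norm_sub (a - b + z) a x
    linarith [dist_eq_norm (a - b + z) a, dist_comm (a - b + z) a, norm_nonneg (b - x)])
  have hfirst : dist (f a) (f (a - b + z)) ≤ L * (η * ‖b - x‖) :=
    (hf.dist_le_mul a haΩ _ hshiftΩ).trans (by rw [hshift]; gcongr)
  have hlast : dist (f z) (f b) ≤ L * (η * ‖b - x‖) :=
    (hf.dist_le_mul z hzΩ b hbΩ).trans (by gcongr)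
  have hmiddle : dist (f (a - b + z)) (f z) ≤ τ (a - b) + ε * ‖a - b‖ := by
    simpa using hz (a - b + z) (by simpa using hab)
  have habx : ε * ‖a - b‖ ≤ ε * (‖a - x‖ + ‖b - x‖) := by
    gcongr
    simpa [norm_sub_rev b x] using norm_sub_le_norm_sub_add_norm_sub a x b
  have hLη : 0 ≤ 2 * L * η * ‖a - x‖ := by positivity
  calc dist (f a) (f b)
      ≤ dist (f a) (f (a - b + z)) + dist (f (a - b + z)) (f z) + dist (f z) (f b) :=
        dist_triangle4 _ _ _ _
    _ ≤ τ (a - b) + (ε + 2 * L * η) * (‖a - x‖ + ‖b - x‖) := by linarith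

theorem IsMetricMajorantAt.exists_mem_uniformMajorantSet {f : E → X} {σ τ : Seminorm ℝ E} {x : E}
    (h : IsMetricMajorantAt f σ x) {η : ℝ} (hη : 0 < η) (hτ : ∀ w, |σ w - τ w| ≤ η * ‖w‖) :
    ∃ j : ℕ, x ∈ uniformMajorantSet f τ (2 * η) (1 / (j + 1)) := by
  obtain ⟨δ, hδ, hbound⟩ := Metric.eventually_nhds_iff.1 (h η hη)
  obtain ⟨j, hj⟩ := exists_nat_one_div_lt hδ
  refine ⟨j, fun y hy => (hbound (hy.trans hj)).trans ?_⟩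
  linarith [(abs_le.1 (hτ (y - x))).2]

theorem ae_isJointMetricMajorantAt_of_isMetricMajorantAt [FiniteDimensional ℝ E]
    [MeasurableSpace E] [BorelSpace E] (μ : Measure E) [IsUnifLocDoublingMeasure μ]
    [IsLocallyFiniteMeasure μ] {f : E → X} {Ω : Set E} (hΩ : IsOpen Ω) {L : ℝ≥0}
    (hf : LipschitzOnWith L f Ω) :
    ∀ᵐ x ∂μ, x ∈ Ω → ∀ σ : Seminorm ℝ E, IsMetricMajorantAt f σ x →
      IsJointMetricMajorantAt f σ x := by
  obtain ⟨τ, hτ⟩ := exists_seq_seminorm_dense E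
  have hdense := ae_all_iff.2 fun l : ℕ => ae_all_iff.2 fun i : ℕ => ae_all_iff.2 fun j : ℕ =>
    ae_eventually_exists_mem_dist_le_mul μ
      (uniformMajorantSet f (τ i) (2 * (1 / ((l : ℝ) + 1))) (1 / ((j : ℝ) + 1)))
      (Nat.one_div_pos_of_nat (n := l))
  filter_upwards [hdense] with x hx hxΩ σ hσ ε hε
  obtain ⟨l, hl⟩ := exists_nat_one_div_lt (show 0 < ε / (2 * L + 3) by positivity)
  have hη : (0 : ℝ) < 1 / ((l : ℝ) + 1) := Nat.one_div_pos_of_nat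
  specialize hx l
  generalize (1 : ℝ) / ((l : ℝ) + 1) = η at hl hη hx
  obtain ⟨i, hi⟩ := hτ σ hη
  obtain ⟨j, hj⟩ := hσ.exists_mem_uniformMajorantSet hη hi
  filter_upwards [eventually_dist_le_of_uniformMajorantSet hf (hΩ.mem_nhds hxΩ) (by positivity)
    hη.le Nat.one_div_pos_of_nat (hx i j hj)] with ⟨a, b⟩ hab
  have hτσ : τ i (a - b) ≤ σ (a - b) + η * (‖a - x‖ + ‖b - x‖) := by
    have htri : η * ‖a - b‖ ≤ η * (‖a - x‖ + ‖b - x‖) := by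
      gcongr
      simpa [norm_sub_rev b x] using norm_sub_le_norm_sub_add_norm_sub a x b
    linarith [(abs_le.1 (hi (a - b))).1]
  have hηε : η * (2 * L + 3) ≤ ε := ((lt_div_iff₀ (by positivity)).1 hl).le
  calc dist (f a) (f b)
      ≤ σ (a - b) + η * (2 * L + 3) * (‖a - x‖ + ‖b - x‖) := by linarith
    _ ≤ σ (a - b) + ε * (‖a - x‖ + ‖b - x‖) := by gcongr

theorem IsJointMetricMajorantAt.eventually_image_ball_subset {f : E → X} {σ : Seminorm ℝ E} {x : E}
    (h : IsJointMetricMajorantAt f σ x) {ι : Type*} [Finite ι] {c : ι → E} {s : ℝ}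
    (hc : ∀ v, ‖v‖ < 1 → ∃ i, σ (v - c i) ≤ s) {ε : ℝ} (hε : 0 < ε) :
    ∀ᶠ r in 𝓝[>] (0 : ℝ),
      f '' Metric.ball x r ⊆ ⋃ i, Metric.ball (f (x + r • c i)) ((s + ε) * r) := by
  obtain ⟨M, hM0, hM⟩ : ∃ M, 0 ≤ M ∧ ∀ i, ‖c i‖ ≤ M := by
    obtain ⟨M, hM⟩ := (Set.finite_range fun i => ‖c i‖).bddAbove
    exact ⟨max M 0, le_max_right _ _, fun i => (hM ⟨i, rfl⟩).trans (le_max_left _ _)⟩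
  obtain ⟨δ, hδ, hbound⟩ := Metric.eventually_nhds_iff.1 (h (ε / (1 + M)) (by positivity))
  filter_upwards [Ioo_mem_nhdsGT (show 0 < δ / (1 + M) by positivity)] with r ⟨hr0, hrδ⟩
  rw [lt_div_iff₀ (by positivity)] at hrδ
  have hrM : 0 ≤ r * M := by positivity
  rintro _ ⟨y, hy, rfl⟩
  have hyr : ‖y - x‖ < r := mem_ball_iff_norm.1 hy
  obtain ⟨i, hi⟩ := hc (r⁻¹ • (y - x)) (by
    rwa [norm_smul, norm_inv, Real.norm_of_nonneg hr0.le, inv_mul_lt_one₀ hr0])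
  have hci : ‖r • c i‖ ≤ r * M := by
    rw [norm_smul, Real.norm_of_nonneg hr0.le]
    gcongr
    exact hM i
  have hσ : σ (y - (x + r • c i)) ≤ r * s := by
    have hscale : y - (x + r • c i) = r • (r⁻¹ • (y - x) - c i) := by
      rw [smul_sub, smul_inv_smul₀ hr0.ne', sub_sub]
    rw [hscale, map_smul_eq_mul, Real.norm_of_nonneg hr0.le]
    gcongr
  have hdist := hbound (y := (y, x + r • c i)) <| by
    rw [Prod.dist_eq, max_lt_iff, dist_eq_norm, dist_eq_norm, add_sub_cancel_left]
    constructor <;> linarith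
  refine Set.mem_iUnion.2 ⟨i, ?_⟩
  calc dist (f y) (f (x + r • c i))
      ≤ σ (y - (x + r • c i)) + ε / (1 + M) * (‖y - x‖ + ‖r • c i‖) := by
        simpa only [add_sub_cancel_left] using hdist
    _ < r * s + ε / (1 + M) * (r + r * M) :=
        add_lt_add_of_le_of_lt hσ (by gcongr 1; exact add_lt_add_of_lt_of_le hyr hci)
    _ = (s + ε) * r := by field_simp

end Majorants

theorem exists_grid_abs_sub_le {m : ℕ} (hm : 1 ≤ m) :
    ∃ t : Fin m → ℝ, ∀ a : ℝ, |a| < 1 → ∃ j, |a - t j| ≤ 1 / m := by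
  have hm0 : (0 : ℝ) < m := by exact_mod_cast hm
  refine ⟨fun j => (2 * j + 1) / m - 1, fun a ha => ?_⟩
  obtain ⟨ha₁, ha₂⟩ := abs_lt.1 ha
  have hq0 : 0 ≤ (a + 1) * m / 2 := by
    have : 0 < a + 1 := by linarith
    positivity
  have hqm : (a + 1) * m / 2 < m := by nlinarith
  refine ⟨⟨⌊(a + 1) * m / 2⌋₊, (Nat.floor_lt hq0).2 hqm⟩, ?_⟩
  have hlower := Nat.floor_le hq0
  have hupper := Nat.lt_floor_add_one ((a + 1) * m / 2)
  have hscale : a - ((2 * (⌊(a + 1) * m / 2⌋₊ : ℝ) + 1) / m - 1)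
      = (2 * ((a + 1) * m / 2 - ⌊(a + 1) * m / 2⌋₊) - 1) / m := by
    field_simp
    ring
  rw [hscale, abs_div, abs_of_pos hm0]
  gcongr
  exact abs_le.2 ⟨by linarith, by linarith⟩

theorem exists_grid_norm_sub_le (ι : Type*) [Fintype ι] {m : ℕ} (hm : 1 ≤ m) :
    ∃ c : (ι → Fin m) → EuclideanSpace ℝ ι, ∀ p, ‖p‖ < 1 →
      ∃ i, ‖p - c i‖ ≤ √(Fintype.card ι) / m := by
  obtain ⟨t, ht⟩ := exists_grid_abs_sub_le hm
  refine ⟨fun i => WithLp.toLp 2 fun l => t (i l), fun p hp => ?_⟩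
  choose i hi using fun l => ht (p l) ((PiLp.norm_apply_le p l).trans_lt hp)
  refine ⟨i, ?_⟩
  calc ‖p - WithLp.toLp 2 fun l => t (i l)‖ = √(∑ l, |p l - t (i l)| ^ 2) := by
        simp [EuclideanSpace.norm_eq]
    _ ≤ √(∑ _l : ι, (1 / (m : ℝ)) ^ 2) := by gcongr with l; exact hi l
    _ = √(Fintype.card ι) / m := by simp [Real.sqrt_mul, div_eq_mul_inv]

/-- Only the component of a vector orthogonal to `N` matters for `σ`: a grid in `Nᗮ` suffices. -/
theorem exists_net_unit_ball_seminorm_sub_le {E : Type*} [NormedAddCommGroup E]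
    [InnerProductSpace ℝ E] {σ : Seminorm ℝ E} {L : ℝ≥0} (hσ : ∀ v, σ v ≤ L * ‖v‖)
    (N : Submodule ℝ E) [N.HasOrthogonalProjection] [FiniteDimensional ℝ Nᗮ]
    (hN : ∀ w ∈ N, σ w = 0) {k : ℕ} (hk : Module.finrank ℝ Nᗮ = k) {m : ℕ} (hm : 1 ≤ m) :
    ∃ c : Fin (m ^ k) → E, ∀ v, ‖v‖ < 1 → ∃ i, σ (v - c i) ≤ √k * L / m := by
  obtain ⟨c, hc⟩ := exists_grid_norm_sub_le (Fin k) hm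
  let b : OrthonormalBasis (Fin k) ℝ Nᗮ := (stdOrthonormalBasis ℝ Nᗮ).reindex (finCongr hk)
  refine ⟨fun i => b.repr.symm (c (finFunctionFinEquiv.symm i)), fun v hv => ?_⟩
  let P : Nᗮ := Nᗮ.orthogonalProjectionOnto v
  obtain ⟨i, hi⟩ := hc (b.repr P) (by
    rw [LinearIsometryEquiv.norm_map]
    exact (Nᗮ.norm_starProjection_apply_le v).trans_lt hv)
  have hPc : ‖P - b.repr.symm (c i)‖ ≤ √k / m := by
    rw [← b.repr.norm_map, map_sub, b.repr.apply_symm_apply]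
    simpa using hi
  have hsplit : v - b.repr.symm (c i) = N.starProjection v + (P - b.repr.symm (c i) : Nᗮ) := by
    have : N.starProjection v + P = v := N.starProjection_add_starProjection_orthogonal v
    rw [Submodule.coe_sub, ← add_sub_assoc, this]
  refine ⟨finFunctionFinEquiv i, ?_⟩
  simp only [Equiv.symm_apply_apply]
  rw [hsplit]
  calc σ (N.starProjection v + (P - b.repr.symm (c i) : Nᗮ))
      ≤ σ (N.starProjection v) + σ (P - b.repr.symm (c i) : Nᗮ) := map_add_le_add σ _ _
    _ = σ (P - b.repr.symm (c i) : Nᗮ) := by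
        rw [hN _ (N.starProjection_apply_mem v), zero_add]
    _ ≤ L * ‖P - b.repr.symm (c i)‖ := hσ _
    _ ≤ L * (√k / m) := by gcongr
    _ = √k * L / m := by ring

theorem finrank_orthogonal_nullSpace {n : ℕ} (σ : Seminorm ℝ (EuclideanSpace ℝ (Fin n))) :
    Module.finrank ℝ σ.nullSpaceᗮ = σ.rank := by
  have hsum := σ.nullSpace.finrank_add_finrank_orthogonal
  rw [finrank_euclideanSpace_fin] at hsum
  rw [Seminorm.rank]
  omega

theorem exists_pos_of_seminorm_rank_pos {n : ℕ} {σ : Seminorm ℝ (EuclideanSpace ℝ (Fin n))}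
    (hσ : 0 < σ.rank) : ∃ v, 0 < σ v := by
  by_contra! hle
  have htop : σ.nullSpace = ⊤ :=
    Submodule.eq_top_iff'.2 fun v => (hle v).antisymm (apply_nonneg σ v)
  rw [Seminorm.rank, htop, finrank_top, finrank_euclideanSpace_fin, Nat.sub_self] at hσ
  exact hσ.false

section MetricDerivative

variable {n : ℕ} {X : Type*} [MetricSpace X] {f : EuclideanSpace ℝ (Fin n) → X}
  {Ω : Set (EuclideanSpace ℝ (Fin n))} {L : ℝ≥0} {k : ℕ}
  {σ : Seminorm ℝ (EuclideanSpace ℝ (Fin n))} {x : EuclideanSpace ℝ (Fin n)}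

theorem HasMetricDerivAt.isLittleO (h : HasMetricDerivAt f σ x) :
    (fun y => dist (f y) (f x) - σ (y - x)) =o[𝓝 x] fun y => ‖y - x‖ := by
  have hpunctured : (fun y => dist (f y) (f x) - σ (y - x)) =o[𝓝[≠] x] fun y => ‖y - x‖ := by
    refine (Asymptotics.isLittleO_iff_tendsto' ?_).2 h
    filter_upwards [self_mem_nhdsWithin] with y hy hyx
    exact absurd (sub_eq_zero.1 (norm_eq_zero.1 hyx)) hy
  simpa using hpunctured.insert (by simp)

theorem HasMetricDerivAt.isMetricMajorantAt (h : HasMetricDerivAt f σ x) :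
    IsMetricMajorantAt f σ x := fun ε hε => by
  filter_upwards [h.isLittleO.def hε] with y hy
  rw [norm_norm, Real.norm_eq_abs] at hy
  linarith [(abs_le.1 hy).2]

theorem HasMetricDerivAt.le_mul_norm (h : HasMetricDerivAt f σ x) (hΩ : Ω ∈ 𝓝 x)
    (hf : LipschitzOnWith L f Ω) (v : EuclideanSpace ℝ (Fin n)) : σ v ≤ L * ‖v‖ := by
  have hε : ∀ ε > 0, σ v ≤ (L + ε) * ‖v‖ := fun ε hε => by
    refine seminorm_le_mul_norm_of_eventually ?_ v
    have hnear : ∀ᶠ y in 𝓝 x, σ (y - x) ≤ (L + ε) * ‖y - x‖ := by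
      filter_upwards [h.isLittleO.def hε, hΩ] with y hy hyΩ
      have hlip := hf.dist_le_mul y hyΩ x (mem_of_mem_nhds hΩ)
      rw [norm_norm, Real.norm_eq_abs] at hy
      rw [dist_eq_norm y x] at hlip
      linarith [(abs_le.1 hy).1]
    have htranslate : Tendsto (fun w => x + w) (𝓝 0) (𝓝 x) :=
      Continuous.tendsto' (by fun_prop) 0 x (add_zero x)
    simpa using htranslate.eventually hnear
  have hlim : Tendsto (fun ε : ℝ => (L + ε) * ‖v‖) (𝓝[>] 0) (𝓝 (L * ‖v‖)) :=
    (Continuous.tendsto' (by fun_prop) 0 _ (by simp)).mono_left nhdsWithin_le_nhds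
  exact ge_of_tendsto hlim (eventually_mem_nhdsWithin.mono hε)

theorem lipschitzConst_pos_of_mem_metricRankSet (hΩ : IsOpen Ω) (hf : LipschitzOnWith L f Ω)
    (hx : x ∈ metricRankSet f Ω k) (hk : 0 < k) : 0 < (L : ℝ) := by
  obtain ⟨hxΩ, σ, hσ, rfl⟩ := hx
  obtain ⟨v, hv⟩ := exists_pos_of_seminorm_rank_pos hk
  exact pos_of_mul_pos_left (hv.trans_le (hσ.le_mul_norm (hΩ.mem_nhds hxΩ) hf v)) (norm_nonneg v)

theorem ae_eventually_image_ball_subset_iUnion_ball (hΩ : IsOpen Ω) (hf : LipschitzOnWith L f Ω)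
    (k : ℕ) :
    ∀ᵐ x, x ∈ metricRankSet f Ω k → ∀ m : ℕ, 1 ≤ m → ∀ ε : ℝ, 0 < ε →
      ∀ᶠ r in 𝓝[>] (0 : ℝ), ∃ c : Fin (m ^ k) → X,
        f '' Metric.ball x r ⊆ ⋃ i, Metric.ball (c i) ((√k * L / m + ε) * r) := by
  filter_upwards [ae_isJointMetricMajorantAt_of_isMetricMajorantAt volume hΩ hf]
    with x hx ⟨hxΩ, σ, hσ, hrank⟩ m hm ε hε
  obtain ⟨c, hc⟩ := exists_net_unit_ball_seminorm_sub_le (hσ.le_mul_norm (hΩ.mem_nhds hxΩ) hf)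
    σ.nullSpace (fun _ hw => hw) ((finrank_orthogonal_nullSpace σ).trans hrank) hm
  exact ((hx hxΩ σ hσ.isMetricMajorantAt).eventually_image_ball_subset hc hε).mono
    fun r hr => ⟨_, hr⟩

end MetricDerivative

theorem proposition3p4 {n : ℕ} {X : Type*} [MetricSpace X]
    (Ω : Set (EuclideanSpace ℝ (Fin n))) (hΩ : IsOpen Ω)
    (f : EuclideanSpace ℝ (Fin n) → X) (L : ℝ≥0) (hf : LipschitzOnWith L f Ω) (k : ℕ) :
    ∀ᵐ x ∂(volume : Measure (EuclideanSpace ℝ (Fin n))), x ∈ metricRankSet f Ω k →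
      ∀ m : ℕ, 1 ≤ m → ∃ ρ : ℝ, 0 < ρ ∧ ∀ r : ℝ, 0 < r → r < ρ →
        Metric.ball x r ⊆ Ω ∧
        (0 < k → ∃ c : Fin (m ^ k) → X,
          f '' Metric.ball x r ⊆ ⋃ i, Metric.ball (c i) (3 * √(k : ℝ) * L * r / m)) ∧
        (k = 0 → ∃ c : X, f '' Metric.ball x r ⊆ Metric.ball c (r / m)) := by
  filter_upwards [ae_eventually_image_ball_subset_iUnion_ball hΩ hf k] with x hcover hx m hm
  refine ((nhdsGT_basis (0 : ℝ)).eventually_iff.1 ?_).imp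
    fun ρ h => ⟨h.1, fun r hr hrρ => h.2 ⟨hr, hrρ⟩⟩
  have hball : ∀ᶠ r in 𝓝[>] (0 : ℝ), Metric.ball x r ⊆ Ω :=
    (eventually_ball_subset (hΩ.mem_nhds hx.1)).filter_mono nhdsWithin_le_nhds
  have : (0 : ℝ) < m := Nat.cast_pos.2 hm
  obtain rfl | hk := k.eq_zero_or_pos
  · filter_upwards [hball, hcover hx m hm (1 / m) (by positivity)] with r hrΩ ⟨c, hc⟩
    refine ⟨hrΩ, fun h => absurd h (lt_irrefl 0), fun _ => ⟨c 0, hc.trans ?_⟩⟩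
    refine Set.iUnion_subset fun i => ?_
    obtain rfl : i = 0 := Fin.fin_one_eq_zero i
    simp [div_eq_inv_mul]
  · have hL := lipschitzConst_pos_of_mem_metricRankSet hΩ hf hx hk
    filter_upwards [hball, hcover hx m hm (2 * √k * L / m) (by positivity)] with r hrΩ ⟨c, hc⟩
    refine ⟨hrΩ, fun _ => ⟨c, ?_⟩, fun h => absurd h hk.ne'⟩
    convert hc using 4
    ring
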